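/- Rings are associative with $1$. Let $R$ be a ring. An element of $R$ is regular if it is neither a left nor a right zero divisor, and $\mathcal{C}_R$ denotes the multiplicative set of regular elements of $R$. A multiplicative set $S\subseteq R$ (with $1\in S$) is a left Ore set if $Sr\cap Rs\neq\emptyset$ for all $r\in R$, $s\in S$. There is a largest left Ore set $S_l(R)$ of $R$ that consists of regular elements; $Q_l(R):=S_l(R)^{-1}R$ is the largest left quotient ring of $R$. The left quotient ring $Q(R):=\mathcal{C}_R^{-1}R$ exists if $\mathcal{C}_R$ is a left Ore set. The ring $R$ is left Goldie if it satisfies the ascending chain condition on left annihilators of subsets and contains no infinite direct sum of nonzero left ideals; it is semiprime if $aRa=0$ with $a\in R$ implies $a=0$. **Theorem 1.1.** Let $R$ be a semiprime ring. The following statements are equivalent: 1. $Q(R)$ exists and is a left Noetherian ring. 2. $Q(R)$ exists and is a semisimple ring. 3. $R$ is a (semiprime) left Goldie ring. 4. $Q_l(R)$ is a left Noetherian ring. 5. $Q_l(R)$ is a semisimple ring. If one of these equivalent conditions holds, then $S_l(R)=\mathcal{C}_R$ and $Q(R)=Q_l(R)$ (that is, $Q(R)$ exists and there is a ring isomorphism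 $Q(R)\cong Q_l(R)$ compatible with the canonical maps from $R$). In particular, if $Q(R)$ exists and is not semisimple, then $Q(R)$ is not left Noetherian; and if $Q_l(R)$ is not semisimple, then $Q_l(R)$ is not left Noetherian. -/

import Mathlib

namespace LeftQuot

universe u

variable (R : Type u) [Ring R]

/-- `R` is semiprime: `a R a = 0` forces `a = 0`. -/
def IsSemiprime : Prop :=
  ∀ a : R, (∀ r : R, a * r * a = 0) → a = 0

variable {R} in
/-- The left annihilator `{r | r x = 0 for all x ∈ X}` of a subset `X` of `R`, a left ideal.
(`Ideal R` is the type of left ideals of `R`.) -/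
def leftAnnihilator (X : Set R) : Ideal R where
  carrier := {r | ∀ x ∈ X, r * x = 0}
  add_mem' := by
    intro a b ha hb x hx
    rw [add_mul, ha x hx, hb x hx, add_zero]
  zero_mem' := by
    intro x _
    exact zero_mul x
  smul_mem' := by
    intro c a ha x hx
    rw [smul_eq_mul, mul_assoc, ha x hx, mul_zero]

/-- `R` is a left Goldie ring: it satisfies the ascending chain condition on left annihilators
and contains no infinite direct sum of nonzero left ideals. -/
structure IsLeftGoldie : Prop where
  acc_leftAnnihilator : ∀ f : ℕ →o Ideal R, (∀ n, ∃ X : Set R, f n = leftAnnihilator X) →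
    ∃ n, ∀ m, n ≤ m → f n = f m
  no_infinite_directSum : ¬ ∃ I : ℕ → Ideal R, (∀ n, I n ≠ ⊥) ∧ iSupIndep I

variable {R}

/-- The left Ore condition: `S r ∩ R s ≠ ∅` for all `r ∈ R` and `s ∈ S`. -/
def LeftOreCondition (S : Submonoid R) : Prop :=
  ∀ r : R, ∀ s ∈ S, ∃ s' ∈ S, ∃ r' : R, s' * r = r' * s

/-- A regular left Ore set: a multiplicative set of regular elements (two-sided non-zero-divisors)
with the left Ore condition. If `R ≠ 0` then `0 ∉ S` is automatic. -/
structure IsRegularLeftOre (S : Submonoid R) : Prop where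
  le_regular : S ≤ nonZeroDivisors R
  ore : LeftOreCondition S

/-- A regular left Ore set is a left denominator set, so that Mathlib's left Ore localization
`S⁻¹ R` is available. -/
@[reducible]
noncomputable def IsRegularLeftOre.oreSet {S : Submonoid R} (h : IsRegularLeftOre S) :
    OreLocalization.OreSet S :=
  Classical.choice <| OreLocalization.nonempty_oreSet_iff.2 <| by
    refine ⟨fun r₁ r₂ s e => ⟨1, ?_⟩, fun r s => ?_⟩
    · have h0 : (r₁ - r₂) * (s : R) = 0 := by rw [sub_mul, e, sub_self]
      rw [sub_eq_zero.1 ((h.le_regular s.2).2 _ h0)]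
    · obtain ⟨s', hs', r', e⟩ := h.ore r s s.2
      exact ⟨r', ⟨s', hs'⟩, e⟩

/-- The left quotient ring `S⁻¹ R` at a regular left Ore set. -/
abbrev IsRegularLeftOre.Localization {S : Submonoid R} (h : IsRegularLeftOre S) : Type u :=
  @OreLocalization R _ S h.oreSet R _

/-- The canonical map `R → S⁻¹ R`, `r ↦ r / 1`. -/
noncomputable def IsRegularLeftOre.ι {S : Submonoid R} (h : IsRegularLeftOre S) :
    R →+* h.Localization :=
  letI := h.oreSet
  OreLocalization.numeratorRingHom

variable (R)

/-- The largest regular left Ore set `S_l(R)`: the supremum of all regular left Ore sets; it is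
itself one by `largestRegularLeftOre_isGreatest`. -/
def largestRegularLeftOre : Submonoid R :=
  sSup {S : Submonoid R | IsRegularLeftOre S}

theorem largestRegularLeftOre_isGreatest :
    IsGreatest {S : Submonoid R | IsRegularLeftOre S} (largestRegularLeftOre R) := by
  refine ⟨⟨sSup_le fun S hS => hS.le_regular, ?_⟩, fun S hS => le_sSup hS⟩
  intro r s hs
  rw [largestRegularLeftOre, sSup_eq_iSup', Submonoid.iSup_eq_closure] at hs
  induction hs using Submonoid.closure_induction generalizing r with
  | mem x hx =>
    obtain ⟨S, hx⟩ := Set.mem_iUnion.1 hx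
    obtain ⟨s', hs', r', e⟩ := S.2.ore r x hx
    exact ⟨s', (le_sSup S.2 : S.1 ≤ largestRegularLeftOre R) hs', r', e⟩
  | one => exact ⟨1, one_mem _, r, by simp⟩
  | mul x y _ _ ihx ihy =>
    obtain ⟨s₁, hs₁, r₁, e₁⟩ := ihy r
    obtain ⟨s₂, hs₂, r₂, e₂⟩ := ihx r₁
    exact ⟨s₂ * s₁, mul_mem hs₂ hs₁, r₂, by rw [mul_assoc, e₁, ← mul_assoc, e₂, mul_assoc]⟩

/-- `S_l(R)` is a regular left Ore set. -/
theorem isRegularLeftOre_largest : IsRegularLeftOre (largestRegularLeftOre R) :=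
  (largestRegularLeftOre_isGreatest R).1

/-- The largest left quotient ring `Q_l(R) = S_l(R)⁻¹ R`. -/
abbrev LargestLeftQuotientRing : Type u :=
  (isRegularLeftOre_largest R).Localization

/-- The left quotient ring `Q(R)` of `R` exists: the set of all regular elements of `R` is a
left Ore set. -/
abbrev HasLeftQuotientRing : Prop :=
  IsRegularLeftOre (nonZeroDivisors R)

variable {R} in
/-- The (classical) left quotient ring `Q(R) = C⁻¹ R`, where `C` is the set of all regular
elements of `R`; it is defined only if it exists. -/
abbrev LeftQuotientRing (h : HasLeftQuotientRing R) : Type u :=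
  h.Localization

end LeftQuot

namespace LeftQuot

universe u v

/-! This is Goldie's theorem, with the Goldie condition linking both quotient rings. It descends to
`R` from any left Noetherian ring of left fractions: left annihilators in `R` are contracted from
`Q`, and independent left ideals extend to independent ones. Conversely, if `R` is semiprime left
Goldie, every essential left ideal contains a regular element
(`IsLeftGoldie.exists_mem_nonZeroDivisors`). Applied to `{x | x r ∈ R c}` this gives the Ore
condition; applied to the contraction of an essential left ideal of `Q` it puts a unit in that
ideal, so `Q` is semisimple. Once the regular elements form an Ore set, they are the largest one. -/

/-! ### Essential left ideals and independent families -/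

/-- A left ideal is essential if it meets every nonzero left ideal nontrivially. -/
def IsEssential {R : Type u} [Ring R] (J : Ideal R) : Prop :=
  ∀ K : Ideal R, Disjoint J K → K = ⊥

section Essential

variable {R : Type u} [Ring R]

theorem isEssential_iff {J : Ideal R} :
    IsEssential J ↔ ∀ x : R, x ≠ 0 → ∃ a : R, a * x ∈ J ∧ a * x ≠ 0 := by
  constructor
  · intro h x hx
    by_contra! hc
    have hspan : Ideal.span {x} = ⊥ := by
      refine h _ (Submodule.disjoint_def.2 fun y hyJ hy => ?_)
      obtain ⟨a, rfl⟩ := Ideal.mem_span_singleton'.1 hy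
      exact hc a hyJ
    exact hx (Ideal.span_singleton_eq_bot.1 hspan)
  · intro h K hK
    by_contra hne
    obtain ⟨x, hxK, hx⟩ := Submodule.exists_mem_ne_zero_of_ne_bot hne
    obtain ⟨a, haJ, ha⟩ := h x hx
    exact ha (Submodule.disjoint_def.1 hK _ haJ (K.mul_mem_left a hxK))

theorem IsEssential.mono {I J : Ideal R} (hI : IsEssential I) (h : I ≤ J) : IsEssential J :=
  fun K hK => hI K (hK.mono_left h)

/-- The left ideal `{x | x r ∈ J}`. -/
def mulRightComap (J : Ideal R) (r : R) : Ideal R :=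
  Submodule.comap (LinearMap.toSpanSingleton R R r) J

theorem mem_mulRightComap {J : Ideal R} {r x : R} : x ∈ mulRightComap J r ↔ x * r ∈ J :=
  Iff.rfl

theorem IsEssential.mulRightComap {J : Ideal R} (hJ : IsEssential J) (r : R) :
    IsEssential (mulRightComap J r) := by
  refine isEssential_iff.2 fun x hx => ?_
  by_cases hxr : x * r = 0
  · exact ⟨1, by simp [mem_mulRightComap, hxr], by simpa using hx⟩
  · obtain ⟨a, ha, hne⟩ := isEssential_iff.1 hJ _ hxr
    refine ⟨a, by rwa [mem_mulRightComap, mul_assoc], fun h0 => hne ?_⟩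
    rw [← mul_assoc, h0, zero_mul]

theorem iSupIndep_of_disjoint_iSup_gt {I : ℕ → Ideal R}
    (h : ∀ n, Disjoint (I n) (⨆ m, ⨆ (_ : n < m), I m)) : iSupIndep I := by
  rw [iSupIndep_iff_supIndep]
  intro s
  induction s using Finset.induction_on_min with
  | empty => exact Finset.supIndep_empty _
  | insert a s ha ih =>
    refine ih.insert ((h a).mono_right (Finset.sup_le fun m hm => ?_))
    exact le_iSup₂_of_le m (ha m hm) le_rfl

theorem isSemisimpleRing_of_isEssential_eq_top
    (h : ∀ J : Ideal R, IsEssential J → J = ⊤) : IsSemisimpleRing R := by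
  refine (isSemisimpleModule_iff R R).2 ⟨fun A => ?_⟩
  obtain ⟨B, -, hB⟩ := zorn_le_nonempty₀ {B : Ideal R | Disjoint A B}
    (fun c hc hchain y hy => ⟨sSup c, hchain.directedOn.disjoint_sSup_right.2 hc,
      fun z hz => le_sSup hz⟩) ⊥ disjoint_bot_right
  refine ⟨B, hB.prop, codisjoint_iff.2 (h _ fun C hC => ?_)⟩
  -- Maximality of `B` makes `A ⊔ B` essential: a `C` disjoint from it could be added to `B`.
  have hd : Disjoint A (B ⊔ C) := Disjoint.disjoint_sup_right_of_disjoint_sup_left hB.prop hC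
  have hCB : C ≤ B := le_sup_right.trans (hB.le_of_ge hd le_sup_left)
  exact le_bot_iff.1 (hC (hCB.trans le_sup_right) le_rfl)

end Essential

/-! ### Left annihilators of elements -/

section Annihilator

variable {R : Type u} [Ring R]

theorem mem_leftAnnihilator_singleton {x r : R} : r ∈ leftAnnihilator {x} ↔ r * x = 0 := by
  change (∀ y ∈ ({x} : Set R), r * y = 0) ↔ _
  simp

theorem IsLeftGoldie.exists_maximal_leftAnnihilator (hG : IsLeftGoldie R) {T : Set R}
    (hT : T.Nonempty) :
    ∃ b ∈ T, ∀ c ∈ T, (∀ y, y * b = 0 → y * c = 0) → ∀ y, y * c = 0 → y * b = 0 := by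
  let A := {I : Ideal R // ∃ X : Set R, I = leftAnnihilator X}
  have hwf : WellFoundedGT A := by
    rw [wellFoundedGT_iff_monotone_chain_condition]
    intro f
    obtain ⟨n, hn⟩ := hG.acc_leftAnnihilator ⟨fun n => (f n).1, fun i j hij => f.monotone hij⟩
      fun n => (f n).2
    exact ⟨n, fun m hm => Subtype.ext (hn m hm)⟩
  let g : R → A := fun x => ⟨leftAnnihilator {x}, {x}, rfl⟩
  obtain ⟨_, ⟨b, hb, rfl⟩, hmax⟩ := hwf.wf.has_min (g '' T) (hT.image g)
  refine ⟨b, hb, fun c hc hbc y hy => ?_⟩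
  have hle : g b ≤ g c := fun z hz =>
    mem_leftAnnihilator_singleton.2 (hbc z (mem_leftAnnihilator_singleton.1 hz))
  have heq : g b = g c := by
    by_contra hne
    exact hmax _ ⟨c, hc, rfl⟩ (lt_of_le_of_ne hle hne)
  have : y ∈ (g b).1 := by
    rw [heq]
    exact mem_leftAnnihilator_singleton.2 hy
  exact mem_leftAnnihilator_singleton.1 this

/-- The left singular ideal of a semiprime left Goldie ring vanishes. -/
theorem IsLeftGoldie.eq_zero_of_isEssential_leftAnnihilator (hG : IsLeftGoldie R)
    (hR : IsSemiprime R) {z : R} (hz : IsEssential (leftAnnihilator {z})) : z = 0 := by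
  by_contra hz0
  obtain ⟨b, ⟨hb0, hb⟩, hmax⟩ := hG.exists_maximal_leftAnnihilator
    (T := {z : R | z ≠ 0 ∧ IsEssential (leftAnnihilator {z})}) ⟨z, hz0, hz⟩
  refine hb0 (hR b fun r => ?_)
  -- By maximality `b` and `b * r * b` have the same left annihilator, yet some `a` kills the second
  -- and not the first.
  by_contra hne
  obtain ⟨a, ha, ha0⟩ := isEssential_iff.1 (hb.mulRightComap r) b hb0
  have ha' : a * (b * r * b) = 0 := by
    have := mem_leftAnnihilator_singleton.1 (mem_mulRightComap.1 ha)
    simpa only [mul_assoc] using this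
  refine ha0 (hmax (b * r * b) ⟨hne, hb.mono fun y hy => ?_⟩ (fun y hy => ?_) a ha')
  · rw [mem_leftAnnihilator_singleton] at hy ⊢
    rw [mul_assoc, ← mul_assoc, hy, zero_mul]
  · rw [mul_assoc, ← mul_assoc, hy, zero_mul]

/-- In a semiprime left Goldie ring every nonzero left ideal contains a nonzero element `x` such
that `x` and `x ^ 2` have the same left annihilator. -/
theorem IsLeftGoldie.exists_mem_leftAnnihilator_mul_self (hG : IsLeftGoldie R)
    (hR : IsSemiprime R) {I : Ideal R} (hI : I ≠ ⊥) :
    ∃ x ∈ I, x ≠ 0 ∧ ∀ y, y * (x * x) = 0 → y * x = 0 := by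
  obtain ⟨a, haI, ha⟩ := Submodule.exists_mem_ne_zero_of_ne_bot hI
  obtain ⟨b, ⟨hb0, s, hs⟩, hmax⟩ := hG.exists_maximal_leftAnnihilator
    (T := {b : R | b ≠ 0 ∧ ∃ s, a * s = b}) ⟨a, ha, 1, mul_one a⟩
  obtain ⟨r, hr⟩ : ∃ r, b * r * b ≠ 0 := by
    by_contra! hc
    exact hb0 (hR b hc)
  have key : ∀ y, y * b * r * b = 0 → y * b = 0 := fun y hy =>
    hmax (b * r * b) ⟨hr, s * r * b, by rw [← hs]; simp only [mul_assoc]⟩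
      (fun y hy => by rw [mul_assoc, ← mul_assoc, hy, zero_mul]) y
      (by simpa only [mul_assoc] using hy)
  have hx : s * r * a * (s * r * a) = s * r * b * r * a := by rw [← hs]; simp only [mul_assoc]
  -- The square is needed: cancelling in `y * x * x * s = 0` ends at `y * s * r * b = 0`, and `x = s
  -- * r * b * r * a` has that left factor `s * r * b`; `s * r * a` does not.
  refine ⟨s * r * a * (s * r * a), I.mul_mem_left _ (I.mul_mem_left _ haI), fun h0 => ?_,
    fun y hy => ?_⟩
  · refine hr ?_
    have h1 : s * r * b * r * b = 0 := by
      rw [show s * r * b * r * b = s * r * b * r * a * s by simp only [← hs, mul_assoc], ← hx, h0,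
        zero_mul]
    have h2 := key (s * r) h1
    rw [← hs] at h2 ⊢
    simpa only [mul_assoc, mul_zero] using congrArg (a * ·) h2
  · rw [hx] at hy ⊢
    have h1 : y * s * r * b * r * b * r * b * r * b = 0 := by
      have := congrArg (· * s) hy
      simp only [zero_mul] at this
      rw [← this]
      simp only [← hs, mul_assoc]
    have h2 := key _ (key _ (key _ h1))
    simp only [← mul_assoc]
    rw [h2, zero_mul, zero_mul]

/-- If `I` met `R c` trivially, then `I, I c, I c², …` would be an infinite direct sum. -/
theorem IsLeftGoldie.isEssential_span_singleton (hG : IsLeftGoldie R) {c : R}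
    (hc : ∀ y, y * c = 0 → y = 0) : IsEssential (Ideal.span {c}) := by
  intro I hI
  by_contra hne
  have hpow : ∀ n y, y * c ^ n = 0 → y = 0 := by
    intro n
    induction n with
    | zero => intro y hy; simpa using hy
    | succ n ih =>
      intro y hy
      exact ih y (hc _ (by rw [mul_assoc, ← pow_succ, hy]))
  let J : ℕ → Ideal R := fun n => Submodule.map (LinearMap.toSpanSingleton R R (c ^ n)) I
  refine hG.no_infinite_directSum ⟨J, fun n hn => ?_, iSupIndep_of_disjoint_iSup_gt fun n => ?_⟩
  · obtain ⟨x, hxI, hx⟩ := Submodule.exists_mem_ne_zero_of_ne_bot hne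
    have : x * c ^ n ∈ J n := ⟨x, hxI, rfl⟩
    rw [hn] at this
    exact hx (hpow n x this)
  · have hle : (⨆ m, ⨆ (_ : n < m), J m) ≤ Ideal.span {c ^ (n + 1)} := by
      refine iSup₂_le fun m hm => ?_
      rintro _ ⟨x, -, rfl⟩
      refine Ideal.mem_span_singleton'.2 ⟨x * c ^ (m - (n + 1)), ?_⟩
      rw [mul_assoc, ← pow_add, Nat.sub_add_cancel hm]
      rfl
    refine Disjoint.mono_right hle (Submodule.disjoint_def.2 ?_)
    rintro _ ⟨x, hxI, rfl⟩ hx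
    obtain ⟨y, hy⟩ := Ideal.mem_span_singleton'.1 hx
    change y * c ^ (n + 1) = x * c ^ n at hy
    have hxy : x = y * c := by
      refine (sub_eq_zero.1 (hpow n _ ?_))
      rw [sub_mul, ← hy, pow_succ', mul_assoc, sub_self]
    have hx0 : x = 0 := Submodule.disjoint_def.1 hI x
      (Ideal.mem_span_singleton'.2 ⟨y, hxy.symm⟩) hxI
    simp [hx0]

/-- If `c x = 0`, the left annihilator of `x` contains the essential ideal `R c`, so `x` is
singular. -/
theorem IsLeftGoldie.mem_nonZeroDivisors (hG : IsLeftGoldie R) (hR : IsSemiprime R) {c : R}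
    (hc : ∀ y, y * c = 0 → y = 0) : c ∈ nonZeroDivisors R := by
  refine ⟨fun x hx => ?_, hc⟩
  refine hG.eq_zero_of_isEssential_leftAnnihilator hR
    ((hG.isEssential_span_singleton hc).mono fun y hy => ?_)
  obtain ⟨a, rfl⟩ := Ideal.mem_span_singleton'.1 hy
  rw [mem_leftAnnihilator_singleton, mul_assoc, hx, mul_zero]

/-- Goldie's lemma: in a semiprime left Goldie ring, essential left ideals contain regular
elements. -/
theorem IsLeftGoldie.exists_mem_nonZeroDivisors (hG : IsLeftGoldie R) (hR : IsSemiprime R)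
    {J : Ideal R} (hJ : IsEssential J) : ∃ c ∈ J, c ∈ nonZeroDivisors R := by
  by_contra! hreg
  -- While `c ∈ G` is not regular, some `a ≠ 0` in `J` has `a c = 0`, and `c + a` is again in `G`.
  -- Iterating from `0` yields elements `a` generating an infinite direct sum.
  let G := {c : R // c ∈ J ∧ ∀ y, y * (c * c) = 0 → y * c = 0}
  have hstep : ∀ c : G, ∃ a : R, a ≠ 0 ∧ a ∈ J ∧ a * c.1 = 0 ∧
      ∀ y, y * (a * a) = 0 → y * a = 0 := by
    rintro ⟨c, hcJ, hcc⟩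
    have hne : J ⊓ leftAnnihilator {c} ≠ ⊥ := by
      intro h0
      have hbot := hJ _ (disjoint_iff.2 h0)
      refine hreg c hcJ (hG.mem_nonZeroDivisors hR fun y hy => ?_)
      have : y ∈ leftAnnihilator {c} := mem_leftAnnihilator_singleton.2 hy
      rwa [hbot] at this
    obtain ⟨x, hx, hx0, hxx⟩ := hG.exists_mem_leftAnnihilator_mul_self hR hne
    exact ⟨x, hx0, hx.1, mem_leftAnnihilator_singleton.1 hx.2, hxx⟩
  choose a ha0 haJ hac haa using hstep
  have hsum : ∀ (c : G) (y : R), y * (c.1 + a c) = 0 → y * c.1 = 0 ∧ y * a c = 0 := by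
    intro c y hy
    have h1 : y * c.1 = 0 := by
      -- Right multiplication by `c` turns `c + a` into `c²`, because `a c = 0`.
      refine c.2.2 y ?_
      have := congrArg (· * c.1) hy
      simpa only [mul_add, add_mul, mul_assoc, hac, mul_zero, add_zero, zero_mul] using this
    exact ⟨h1, by simpa only [mul_add, h1, zero_add] using hy⟩
  let next : G → G := fun c => ⟨c.1 + a c, J.add_mem c.2.1 (haJ c), fun y hy => by
    obtain ⟨h1, h2⟩ := hsum c (y * (c.1 + a c)) (by rw [mul_assoc, hy])
    have h3 : y * c.1 = 0 := c.2.2 y <| by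
      simpa only [mul_add, add_mul, mul_assoc, hac, mul_zero, add_zero] using h1
    have h4 : y * a c = 0 := haa c y <| by
      simpa only [mul_add, add_mul, h3, zero_mul, zero_add, mul_assoc] using h2
    rw [mul_add, h3, h4, add_zero]⟩
  let c : ℕ → G := fun n => next^[n] ⟨0, J.zero_mem, fun y _ => mul_zero y⟩
  have hc_succ : ∀ n, c (n + 1) = next (c n) := fun n => Function.iterate_succ_apply' _ _ _
  have hann : ∀ n k y, y * (c (n + k)).1 = 0 → y * (c n).1 = 0 := by
    intro n k
    induction k with
    | zero => exact fun y hy => hy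
    | succ k ih =>
      intro y hy
      rw [← add_assoc, hc_succ] at hy
      exact ih y (hsum _ y hy).1
  have hmul : ∀ n m, n < m → a (c m) * a (c n) = 0 := by
    intro n m hnm
    obtain ⟨k, rfl⟩ := Nat.exists_eq_add_of_lt hnm
    have h1 : a (c (n + k + 1)) * (c (n + 1)).1 = 0 :=
      hann (n + 1) k _ (by rw [add_right_comm]; exact hac _)
    rw [hc_succ n] at h1
    exact (hsum _ _ h1).2
  refine hG.no_infinite_directSum ⟨fun n => Ideal.span {a (c n)},
    fun n hn => ha0 _ (Ideal.span_singleton_eq_bot.1 hn),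
    iSupIndep_of_disjoint_iSup_gt fun n => ?_⟩
  -- Later generators annihilate `a (c n)`, while `R a ∩ ann a = 0` since `a` and `a²` have the same
  -- left annihilator.
  have hle : (⨆ m, ⨆ (_ : n < m), Ideal.span {a (c m)}) ≤ leftAnnihilator {a (c n)} :=
    iSup₂_le fun m hm => (Ideal.span_singleton_le_iff_mem _).2
      (mem_leftAnnihilator_singleton.2 (hmul n m hm))
  refine Disjoint.mono_right hle (Submodule.disjoint_def.2 fun x hx hx' => ?_)
  obtain ⟨y, rfl⟩ := Ideal.mem_span_singleton'.1 hx
  rw [mem_leftAnnihilator_singleton, mul_assoc] at hx'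
  exact haa _ y hx'

/-- Goldie's theorem, first half: a semiprime left Goldie ring has a left quotient ring. -/
theorem IsLeftGoldie.hasLeftQuotientRing (hG : IsLeftGoldie R) (hR : IsSemiprime R) :
    HasLeftQuotientRing R := by
  refine ⟨le_rfl, fun r c hc => ?_⟩
  obtain ⟨s, hs, hs'⟩ := hG.exists_mem_nonZeroDivisors hR
    ((hG.isEssential_span_singleton hc.2).mulRightComap r)
  obtain ⟨r', hr'⟩ := Ideal.mem_span_singleton'.1 (mem_mulRightComap.1 hs)
  exact ⟨s, hs', r', hr'.symm⟩

end Annihilator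

/-! ### Left rings of fractions -/

/-- `f : R → Q` exhibits `Q` as the ring of left fractions of `R` with denominators in `S`. -/
structure IsLeftFractionRing {R : Type u} {Q : Type v} [Ring R] [Ring Q] (S : Submonoid R)
    (f : R →+* Q) : Prop where
  injective : Function.Injective f
  isUnit : ∀ s ∈ S, IsUnit (f s)
  exists_mul_eq : ∀ q : Q, ∃ s ∈ S, ∃ r : R, f s * q = f r

theorem IsRegularLeftOre.isLeftFractionRing {R : Type u} [Ring R] {S : Submonoid R}
    (h : IsRegularLeftOre S) : IsLeftFractionRing S h.ι := by
  let := h.oreSet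
  refine ⟨?_, fun s hs => OreLocalization.numerator_isUnit (⟨s, hs⟩ : S), fun q => ?_⟩
  · exact OreLocalization.numeratorHom_inj fun s hs => (h.le_regular hs).1
  · induction q using OreLocalization.ind with
    | _ r s =>
      exact ⟨s, s.2, r, OreLocalization.mul_cancel⟩

namespace IsLeftFractionRing

variable {R : Type u} {Q : Type v} [Ring R] [Ring Q] {S : Submonoid R} {f : R →+* Q}

theorem eq_zero_of_mul_eq_zero (hf : IsLeftFractionRing S f) {s : R} (hs : s ∈ S) {q : Q}
    (h : f s * q = 0) : q = 0 :=
  (hf.isUnit s hs).mul_right_eq_zero.1 h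

theorem map_eq_zero (hf : IsLeftFractionRing S f) {r : R} : f r = 0 ↔ r = 0 :=
  map_eq_zero_iff f hf.injective

theorem exists_mul_eq_mul (hf : IsLeftFractionRing S f) (q : Q) {s : R} (hs : s ∈ S) :
    ∃ t ∈ S, ∃ r : R, f t * q = f r * f s := by
  obtain ⟨v, hv⟩ := (hf.isUnit s hs).exists_left_inv
  obtain ⟨t, ht, r, e⟩ := hf.exists_mul_eq (q * v)
  exact ⟨t, ht, r, by rw [← e, mul_assoc, mul_assoc, hv, mul_one]⟩

/-- Common left denominators keep the set of fractions `s⁻¹ i` closed under addition. -/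
theorem exists_mul_eq_of_mem_map (hf : IsLeftFractionRing S f) {I : Ideal R} {q : Q}
    (hq : q ∈ I.map f) : ∃ s ∈ S, ∃ i ∈ I, f s * q = f i := by
  induction hq using Submodule.span_induction with
  | mem x hx =>
    obtain ⟨i, hi, rfl⟩ := hx
    exact ⟨1, S.one_mem, i, hi, by simp⟩
  | zero => exact ⟨1, S.one_mem, 0, I.zero_mem, by simp⟩
  | add x y _ _ ihx ihy =>
    obtain ⟨s, hs, i, hi, e⟩ := ihx
    obtain ⟨s', hs', j, hj, e'⟩ := ihy
    obtain ⟨t, ht, r, h⟩ := hf.exists_mul_eq_mul (f s') hs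
    refine ⟨t * s', S.mul_mem ht hs', r * i + t * j,
      I.add_mem (I.mul_mem_left _ hi) (I.mul_mem_left _ hj), ?_⟩
    rw [map_add, map_mul, map_mul, map_mul, mul_add, ← e, ← e', ← mul_assoc, ← mul_assoc, h]
  | smul a x _ ih =>
    obtain ⟨s, hs, i, hi, e⟩ := ih
    obtain ⟨t, ht, r, h⟩ := hf.exists_mul_eq_mul a hs
    refine ⟨t, ht, r * i, I.mul_mem_left _ hi, ?_⟩
    rw [smul_eq_mul, ← mul_assoc, h, mul_assoc, e, map_mul]

theorem disjoint_map (hf : IsLeftFractionRing S f) {I J : Ideal R} (h : Disjoint I J) :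
    Disjoint (I.map f) (J.map f) := by
  refine Submodule.disjoint_def.2 fun q hI hJ => ?_
  obtain ⟨s, hs, i, hi, e⟩ := hf.exists_mul_eq_of_mem_map hI
  obtain ⟨s', hs', j, hj, e'⟩ := hf.exists_mul_eq_of_mem_map hJ
  obtain ⟨t, ht, r, hr⟩ := hf.exists_mul_eq_mul (f s') hs
  have hij : t * j = r * i := hf.injective <| by
    rw [map_mul, map_mul, ← e, ← e', ← mul_assoc, ← mul_assoc, hr]
  have h0 : t * j = 0 := Submodule.disjoint_def.1 h _ (hij ▸ I.mul_mem_left _ hi)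
    (J.mul_mem_left _ hj)
  refine hf.eq_zero_of_mul_eq_zero hs' (hf.eq_zero_of_mul_eq_zero ht ?_)
  rw [e', ← map_mul, h0, map_zero]

theorem map_eq_bot_iff (hf : IsLeftFractionRing S f) {I : Ideal R} : I.map f = ⊥ ↔ I = ⊥ := by
  refine ⟨fun h => (Submodule.eq_bot_iff _).2 fun x hx => ?_, fun h => by rw [h, Ideal.map_bot]⟩
  have := Ideal.mem_map_of_mem f hx
  rw [h] at this
  exact hf.map_eq_zero.1 this

theorem isEssential_comap (hf : IsLeftFractionRing S f) {J : Ideal Q} (hJ : IsEssential J) :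
    IsEssential (J.comap f) := by
  intro I hI
  refine hf.map_eq_bot_iff.1 (hJ _ (Submodule.disjoint_def.2 fun q hqJ hq => ?_))
  obtain ⟨s, hs, i, hi, e⟩ := hf.exists_mul_eq_of_mem_map hq
  have hiJ : i ∈ J.comap f := by
    rw [Ideal.mem_comap, ← e]
    exact J.mul_mem_left _ hqJ
  refine hf.eq_zero_of_mul_eq_zero hs ?_
  rw [e, Submodule.disjoint_def.1 hI i hiJ hi, map_zero]

/-- A ring with a left Noetherian ring of left fractions is left Goldie. -/
theorem isLeftGoldie (hf : IsLeftFractionRing S f) [IsNoetherianRing Q] : IsLeftGoldie R := by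
  constructor
  · intro g hg
    -- `F n` annihilates the image of the right annihilator of `g n`; as `g n` is itself a left
    -- annihilator, `F n` contracts to it.
    let F : ℕ →o Ideal Q :=
      ⟨fun n => leftAnnihilator {q | ∃ x : R, (∀ r ∈ g n, r * x = 0) ∧ q = f x}, by
        rintro m n hmn q hq _ ⟨x, hx, rfl⟩
        exact hq _ ⟨x, fun r hr => hx r (g.monotone hmn hr), rfl⟩⟩
    have hmem : ∀ n r, r ∈ g n ↔ f r ∈ F n := by
      intro n r
      constructor
      · rintro hr _ ⟨x, hx, rfl⟩
        rw [← map_mul, hx r hr, map_zero]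
      · intro hr
        obtain ⟨X, hX⟩ := hg n
        rw [hX]
        intro x hx
        have := hr (f x) ⟨x, fun r' hr' => by rw [hX] at hr'; exact hr' x hx, rfl⟩
        rwa [← map_mul, hf.map_eq_zero] at this
    obtain ⟨n, hn⟩ := monotone_stabilizes_iff_noetherian.2 ‹IsNoetherianRing Q› F
    exact ⟨n, fun m hm => by ext r; rw [hmem, hmem, hn m hm]⟩
  · rintro ⟨I, hI, hind⟩
    have hind' : iSupIndep fun n => (I n).map f := fun n => by
      simpa only [Ideal.map_iSup] using hf.disjoint_map (hind n)
    have := WellFoundedGT.finite_of_iSupIndep hind' fun n h => hI n (hf.map_eq_bot_iff.1 h)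
    exact not_finite ℕ

/-- Goldie's theorem, second half: the left quotient ring of a semiprime left Goldie ring is
semisimple. -/
theorem isSemisimpleRing (hf : IsLeftFractionRing (nonZeroDivisors R) f) (hR : IsSemiprime R)
    (hG : IsLeftGoldie R) : IsSemisimpleRing Q := by
  refine isSemisimpleRing_of_isEssential_eq_top fun J hJ => ?_
  obtain ⟨c, hcJ, hc⟩ := hG.exists_mem_nonZeroDivisors hR (hf.isEssential_comap hJ)
  exact J.eq_top_of_isUnit_mem hcJ (hf.isUnit c hc)

end IsLeftFractionRing

/-! ### Comparison of `Q(R)` and `Q_l(R)` -/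

section Comparison

variable {R : Type u} [Ring R]

theorem HasLeftQuotientRing.largestRegularLeftOre_eq (h : HasLeftQuotientRing R) :
    largestRegularLeftOre R = nonZeroDivisors R :=
  le_antisymm (isRegularLeftOre_largest R).le_regular
    ((largestRegularLeftOre_isGreatest R).2 h)

theorem IsRegularLeftOre.exists_ringEquiv {S T : Submonoid R} (hS : IsRegularLeftOre S)
    (hT : IsRegularLeftOre T) (h : S = T) :
    ∃ e : hS.Localization ≃+* hT.Localization, ∀ r : R, e (hS.ι r) = hT.ι r := by
  subst h
  exact ⟨RingEquiv.refl _, fun _ => rfl⟩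

end Comparison

end LeftQuot

theorem theorem1p1 {R : Type*} [Ring R] (hR : LeftQuot.IsSemiprime R) :
    List.TFAE
      [∃ h : LeftQuot.HasLeftQuotientRing R, IsNoetherianRing (LeftQuot.LeftQuotientRing h),
        ∃ h : LeftQuot.HasLeftQuotientRing R, IsSemisimpleRing (LeftQuot.LeftQuotientRing h),
        LeftQuot.IsSemiprime R ∧ LeftQuot.IsLeftGoldie R,
        IsNoetherianRing (LeftQuot.LargestLeftQuotientRing R),
        IsSemisimpleRing (LeftQuot.LargestLeftQuotientRing R)] ∧
    (LeftQuot.IsLeftGoldie R →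
      LeftQuot.largestRegularLeftOre R = nonZeroDivisors R ∧
      ∃ h : LeftQuot.HasLeftQuotientRing R,
        ∃ e : LeftQuot.LeftQuotientRing h ≃+* LeftQuot.LargestLeftQuotientRing R,
          ∀ r : R, e (h.ι r) = (LeftQuot.isRegularLeftOre_largest R).ι r) ∧
    (∀ h : LeftQuot.HasLeftQuotientRing R,
      ¬ IsSemisimpleRing (LeftQuot.LeftQuotientRing h) →
        ¬ IsNoetherianRing (LeftQuot.LeftQuotientRing h)) ∧
    (¬ IsSemisimpleRing (LeftQuot.LargestLeftQuotientRing R) →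
      ¬ IsNoetherianRing (LeftQuot.LargestLeftQuotientRing R)) := by

  open LeftQuot in
  have h12 : ∀ h : HasLeftQuotientRing R, IsNoetherianRing (LeftQuotientRing h) →
      IsSemisimpleRing (LeftQuotientRing h) := fun h _ =>
    h.isLeftFractionRing.isSemisimpleRing hR h.isLeftFractionRing.isLeftGoldie
  have h35 : LeftQuot.IsLeftGoldie R → IsSemisimpleRing (LeftQuot.LargestLeftQuotientRing R) := by
    intro hG
    refine LeftQuot.IsLeftFractionRing.isSemisimpleRing
      (f := (LeftQuot.isRegularLeftOre_largest R).ι) ?_ hR hG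
    -- The Goldie condition forces `S_l(R)` to be all regular elements, so the semisimplicity
    -- criterion applies.
    exact (hG.hasLeftQuotientRing hR).largestRegularLeftOre_eq ▸
      (LeftQuot.isRegularLeftOre_largest R).isLeftFractionRing
  have h43 : IsNoetherianRing (LeftQuot.LargestLeftQuotientRing R) → LeftQuot.IsLeftGoldie R :=
    fun _ => (LeftQuot.isRegularLeftOre_largest R).isLeftFractionRing.isLeftGoldie
  refine ⟨?_, fun hG => ?_, fun h hns hN => hns (h12 h hN), fun hns hN => hns (h35 (h43 hN))⟩
  · tfae_have 1 → 2 := fun ⟨h, hN⟩ => ⟨h, h12 h hN⟩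
    tfae_have 2 → 1 := fun ⟨h, hs⟩ => ⟨h, inferInstance⟩
    tfae_have 1 → 3 := fun ⟨h, hN⟩ => ⟨hR, h.isLeftFractionRing.isLeftGoldie⟩
    tfae_have 3 → 2 := fun ⟨_, hG⟩ => ⟨hG.hasLeftQuotientRing hR,
      (hG.hasLeftQuotientRing hR).isLeftFractionRing.isSemisimpleRing hR hG⟩
    tfae_have 3 → 5 := fun ⟨_, hG⟩ => h35 hG
    tfae_have 5 → 4 := fun hs => inferInstance
    tfae_have 4 → 3 := fun hN => ⟨hR, h43 hN⟩
    tfae_finish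
  · have h := hG.hasLeftQuotientRing hR
    exact ⟨h.largestRegularLeftOre_eq, h, LeftQuot.IsRegularLeftOre.exists_ringEquiv _ _
      h.largestRegularLeftOre_eq.symm⟩
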